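/- **Setting.** Let $(\mathcal A,\varphi)$ be a $W^*$-probability space: $\mathcal A$ is a von Neumann algebra and $\varphi$ is a faithful normal tracial state on $\mathcal A$. Let $L(a)$ and $R(a)$ be the operators of left and right multiplication by $a\in\mathcal A$ on $L^2(\mathcal A,\varphi)$, and let $B(L^2(\mathcal A,\varphi))$ carry the state $T\mapsto\langle Te,e\rangle$, where $e$ is the vector given by the unit of $\mathcal A$. Let $\kappa_n$ denote the free cumulants of $(\mathcal A,\varphi)$ and $\kappa_\chi$ the bi-free cumulants of $B(L^2(\mathcal A,\varphi))$ with this state. For $\chi:\{1,\dots,n\}\to\{l,r\}$ let $s_\chi(1),\dots,s_\chi(n)$ list the elements of $\chi^{-1}(l)$ in increasing order and then those of $\chi^{-1}(r)$ in decreasing order. A pair $(X,Y)$ of operators is *R-diagonal* if $\kappa_\chi(Z_1,\dots,Z_n)=0$ for all $n$, all $\chi$ and all words $Z_1,\dots,Z_n$ with $Z_i\in\{X,X^*\}$ when $\chi(i)=l$ and $Z_i\in\{Y,Y^*\}$ when $\chi(i)=r$, unless $n$ is even and starred and unstarred letters alternate in $Z_{s_\chi(1)},\dots,Z_{s_\chi(n)}$.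 The *$*$-distribution* of $(X,Y)$ is the family of expectations of all words in $X,X^*,Y,Y^*$. For $x,y\in\mathcal A$, $n\ge1$ and $k_1,k_2\ge0$ with $k_1+k_2=2n$, consider the two words of length $2n$ in which starred and unstarred letters alternate, whose first $k_1$ letters are from $\{x,x^*\}$ and whose last $k_2$ letters are from $\{y,y^*\}$. Multiplying consecutive letters in pairs gives the $n$-tuple $(xx^*,\dots,yy^*)$ if the word begins with an unstarred letter, and $(x^*x,\dots,y^*y)$ if it begins with a starred one; if $k_1$ is odd, one entry is $xy^*$, respectively $x^*y$. The free cumulants $\kappa_n(xx^*,\dots,yy^*)$ and $\kappa_n(x^*x,\dots,y^*y)$ of all these tuples (over all $n,k_1,k_2$) are called the mixed cumulants of $(x,y)$. **Proposition 3.1.** (a) If $(L(x),R(y))$ is R-diagonal, then its $*$-distribution is determined by the mixed cumulants of $(x,y)$: there is a map $F$, independent of $(\mathcal A,\varphi)$, $x$ and $y$, such that for every $W^*$-probability space $(\mathcal A,\varphi)$ and all $x,y\in\mathcal A$ with $(L(x),R(y))$ R-diagonal, the $*$-distribution of $(L(x),R(y))$ is the value of $F$ at the family of mixed cumulants of $(x,y)$.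 (b) Let $x_1,y_1,x_2,y_2\in\mathcal A$ be such that $(L(x_1),R(y_1))$ and $(L(x_2),R(y_2))$ are R-diagonal. If $$\kappa_n(x_1x_1^*,\dots,y_1y_1^*)=\kappa_n(x_2x_2^*,\dots,y_2y_2^*),\qquad \kappa_n(x_1^*x_1,\dots,y_1^*y_1)=\kappa_n(x_2^*x_2,\dots,y_2^*y_2)$$ for all $n\ge1$ and all $k_1,k_2\ge0$ with $k_1+k_2=2n$, then $(L(x_1),R(y_1))$ and $(L(x_2),R(y_2))$ are identically $*$-distributed. -/

import Mathlib

open scoped ComplexOrder InnerProductSpace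

universe u

namespace BiFree

/-! ### Cumulants over a noncommutative probability space -/

section Cumulants

/-- A partition of a finite set `S` is non-crossing for the order `prec` if there are no two
distinct blocks `V`, `W` with `a, c ∈ V`, `b, d ∈ W` and `a ≺ b ≺ c ≺ d`. -/
def IsNonCrossing {ι : Type*} [DecidableEq ι] (prec : ι → ι → Prop) {S : Finset ι}
    (π : Finpartition S) : Prop :=
  ∀ V ∈ π.parts, ∀ W ∈ π.parts, V ≠ W →
    ∀ a ∈ V, ∀ b ∈ W, ∀ c ∈ V, ∀ d ∈ W, ¬ (prec a b ∧ prec b c ∧ prec c d)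

open Classical in
/-- The cumulants attached to a family of moments `m` (one moment for each finite set of indices)
and to the partitions that are non-crossing for the order `prec`. They are determined by the
moment-cumulant formula `m S = ∑ π, ∏ V ∈ π, cumulant V`, the sum being over all non-crossing
partitions `π` of the non-empty set `S`; here it is solved for the term of the one-block
partition `{S}`. -/
noncomputable def cumulant {ι : Type*} [DecidableEq ι] (prec : ι → ι → Prop)
    (m : Finset ι → ℂ) (S : Finset ι) : ℂ :=
  m S - ∑ π : {π : Finpartition S // IsNonCrossing prec π ∧ S ∉ π.parts},
    ∏ V : {V : Finset ι // V ∈ π.1.parts}, cumulant prec m V.1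
termination_by S.card
decreasing_by
  have h1 : V.1 ⊆ S := π.1.le V.2
  have h2 : V.1 ≠ S := fun h => π.2.2 (by have hV := V.2; rwa [h] at hV)
  exact Finset.card_lt_card (h1.ssubset_of_ne h2)

open Classical in
/-- The moment-cumulant formula. -/
theorem moment_eq_sum_cumulant {ι : Type*} [DecidableEq ι] (prec : ι → ι → Prop)
    (m : Finset ι → ℂ) (S : Finset ι) (hS : S.Nonempty) :
    m S = ∑ π : {π : Finpartition S // IsNonCrossing prec π},
      ∏ V ∈ π.1.parts, cumulant prec m V := by
  have hi : IsNonCrossing prec (Finpartition.indiscrete hS.ne_empty) := by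
    intro V hV W hW hne
    simp [Finpartition.indiscrete] at hV hW
    exact absurd (hV.trans hW.symm) hne
  have hone : ∀ π : Finpartition S, S ∈ π.parts → π = Finpartition.indiscrete hS.ne_empty := by
    intro π hπ
    apply Finpartition.ext
    ext V
    simp only [Finpartition.indiscrete, Finset.mem_singleton]
    constructor
    · intro hV
      by_contra hne
      have := π.disjoint hV hπ hne
      have h2 := π.nonempty_of_mem_parts hV
      obtain ⟨v, hv⟩ := h2
      exact Finset.disjoint_left.mp this hv (π.le hV hv)
    · rintro rfl; exact hπ
  have h1 : cumulant prec m S = m S - ∑ π : {π : Finpartition S // IsNonCrossing prec π ∧ S ∉ π.parts},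
      ∏ V ∈ π.1.parts, cumulant prec m V := by
    rw [cumulant]
    congr 1
    refine Finset.sum_congr rfl fun π _ => ?_
    exact Finset.prod_coe_sort π.1.parts (fun V => cumulant prec m V)
  rw [← Finset.add_sum_erase _ _ (Finset.mem_univ (⟨_, hi⟩ : {π : Finpartition S // IsNonCrossing prec π}))]
  have h2 : ∑ π ∈ Finset.univ.erase (⟨_, hi⟩ : {π : Finpartition S // IsNonCrossing prec π}), ∏ V ∈ π.1.parts, cumulant prec m V = ∑ π : {π : Finpartition S // IsNonCrossing prec π ∧ S ∉ π.parts},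
      ∏ V ∈ π.1.parts, cumulant prec m V := by
    refine Finset.sum_bij' (fun π h => ⟨π.1, π.2, fun hS' => ?_⟩) (fun π _ => ⟨π.1, π.2.1⟩) ?_ ?_ ?_ ?_ ?_
    · exact (Finset.mem_erase.mp h).1 (Subtype.ext (hone _ hS'))
    · simp
    · intro π _
      refine Finset.mem_erase.mpr ⟨fun h => π.2.2 ?_, Finset.mem_univ _⟩
      have := congrArg Subtype.val h
      simp only at this
      rw [this]; simp [Finpartition.indiscrete]
    all_goals simp
  rw [h2]
  simp only [Finpartition.indiscrete, Finset.prod_singleton]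
  rw [h1]; ring

variable {B : Type*} [Ring B] [Algebra ℂ B]

/-- The moment `φ (T i₁ ⋯ T iₖ)` of the subtuple of `T` with index set `S = {i₁ < ⋯ < iₖ}`. -/
noncomputable def tupleMoment (φ : B →ₗ[ℂ] ℂ) {n : ℕ} (T : Fin n → B) (S : Finset (Fin n)) : ℂ :=
  φ (((S.sort (· ≤ ·)).map T).prod)

/-- The free cumulant `κ_n (T 1, …, T n)`. -/
noncomputable def freeCumulant (φ : B →ₗ[ℂ] ℂ) {n : ℕ} (T : Fin n → B) : ℂ :=
  cumulant (· < ·) (tupleMoment φ T) Finset.univ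

/-- The two faces (left and right) of a pair. -/
inductive Face where
  | left
  | right
  deriving DecidableEq

/-- The order `≺_χ` on `{1, …, n}`: first the left indices in increasing order, then the right
indices in decreasing order. -/
def chiLT {n : ℕ} (χ : Fin n → Face) (i j : Fin n) : Prop :=
  match χ i, χ j with
  | .left, .left => i < j
  | .left, .right => True
  | .right, .left => False
  | .right, .right => j < i

/-- The sequence `s_χ(1), …, s_χ(n)`, which lists `{1, …, n}` in the order `≺_χ`. -/
def chiList {n : ℕ} (χ : Fin n → Face) : List (Fin n) :=
  (List.finRange n).filter (fun i => χ i = .left) ++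
    ((List.finRange n).filter (fun i => χ i = .right)).reverse

/-- `chiList χ` is increasing for `≺_χ` … -/
theorem chiList_pairwise {n : ℕ} (χ : Fin n → Face) : (chiList χ).Pairwise (chiLT χ) := by
  unfold chiList
  rw [List.pairwise_append]
  refine ⟨?_, ?_, ?_⟩
  · refine List.Pairwise.imp_of_mem ?_ ((List.pairwise_lt_finRange n).filter _)
    intro a b ha hb h
    simp at ha hb
    simp [chiLT, ha, hb, h]
  · rw [List.pairwise_reverse]
    refine List.Pairwise.imp_of_mem ?_ ((List.pairwise_lt_finRange n).filter _)
    intro a b ha hb h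
    simp at ha hb
    simp [chiLT, ha, hb, h]
  · intro a ha b hb
    simp at ha hb
    simp [chiLT, ha, hb]

/-- … and lists every index exactly once. -/
theorem chiList_perm {n : ℕ} (χ : Fin n → Face) : (chiList χ).Perm (List.finRange n) := by
  unfold chiList
  refine (List.Perm.append_left _ (List.reverse_perm _)).trans ?_
  have : (fun i => decide (χ i = .right)) = (fun i => !decide (χ i = .left)) := by
    funext i; cases h : χ i <;> simp
  rw [this]
  exact List.filter_append_perm _ _

/-- The bi-free cumulant `κ_χ (T 1, …, T n)`: bi-non-crossing partitions are those that are
non-crossing for `≺_χ`, while moments are taken in the natural order of the indices. -/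
noncomputable def biFreeCumulant (φ : B →ₗ[ℂ] ℂ) {n : ℕ} (χ : Fin n → Face) (T : Fin n → B) : ℂ :=
  cumulant (chiLT χ) (tupleMoment φ T) Finset.univ

variable [StarRing B]

/-- The letters of the two-faced family `((x, x*), (y, y*))`: `x` or `x*` on the left face, `y` or
`y*` on the right face; the Boolean says whether the letter is starred. -/
def letter (x y : B) : Face → Bool → B
  | .left, false => x
  | .left, true => star x
  | .right, false => y
  | .right, true => star y

/-- `(x, y)` is an R-diagonal pair in `(B, φ)`: the bi-free cumulants of `((x, x*), (y, y*))` of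
odd order vanish, and so do those of even order, unless starred and unstarred letters alternate
when the letters are listed in the order `≺_χ`. -/
def IsRDiagonal (φ : B →ₗ[ℂ] ℂ) (x y : B) : Prop :=
  ∀ (n : ℕ) (χ : Fin n → Face) (ω : Fin n → Bool),
    ¬ (Even n ∧ ((chiList χ).map ω).IsChain (· ≠ ·)) →
      biFreeCumulant φ χ (fun i => letter x y (χ i) (ω i)) = 0

/-- The `*`-moments of the pair `(x, y)` in `(B, φ)`, that is, the `*`-distribution of `(x, y)`
evaluated at all words in `X, X*, Y, Y*`. -/
def starMoment (φ : B →ₗ[ℂ] ℂ) (x y : B) (w : List (Face × Bool)) : ℂ :=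
  φ ((w.map fun p => letter x y p.1 p.2).prod)

/-- The pairs `(x₁, y₁)` and `(x₂, y₂)` are identically `*`-distributed. -/
def IdenticallyStarDistributed (φ : B →ₗ[ℂ] ℂ) (x₁ y₁ x₂ y₂ : B) : Prop :=
  ∀ w : List (Face × Bool), starMoment φ x₁ y₁ w = starMoment φ x₂ y₂ w

/-- The tuple of length `n` that is obtained from the word of length `2 n` in which starred and
unstarred letters alternate, whose first `k` letters are from `{x, x*}` and whose other letters are
from `{y, y*}`, by multiplying the letters in consecutive pairs. The word begins with an unstarred
letter if `ε = false`, which gives `(x x*, …, y y*)`, and with a starred letter if `ε = true`,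
which gives `(x* x, …, y* y)`. If `k` is odd, one entry is `x y*` or `x* y`. -/
def mixedTuple (x y : B) (n k : ℕ) (ε : Bool) (i : Fin n) : B :=
  letter x y (if 2 * (i : ℕ) < k then .left else .right) ε *
    letter x y (if 2 * (i : ℕ) + 1 < k then .left else .right) (!ε)

/-- The free cumulant of order `n` of `mixedTuple x y n k ε`. -/
noncomputable def mixedCumulant (φ : B →ₗ[ℂ] ℂ) (x y : B) (n k : ℕ) (ε : Bool) : ℂ :=
  freeCumulant φ (mixedTuple x y n k ε)

end Cumulants

/-! ### The standard form of a tracial W*-probability space -/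

section StandardForm

variable {A : Type*} [CStarAlgebra A] [PartialOrder A] [StarOrderedRing A]

/-- `φ` is a faithful normal tracial state. Normality: `φ` preserves suprema of increasing nets. -/
structure IsFaithfulNormalTracialState (φ : A →ₚ[ℂ] ℂ) : Prop where
  map_one : φ 1 = 1
  tracial : ∀ a b : A, φ (a * b) = φ (b * a)
  faithful : ∀ a : A, φ (star a * a) = 0 → a = 0
  normal : ScottContinuous φ

/-- `L(a)` on `L²(A, φ)`: the extension of `b ↦ a b` to the completion of `A` with respect to the
inner product `⟪b, c⟫ = φ (b* c)`. -/
noncomputable def leftMul (φ : A →ₚ[ℂ] ℂ) (a : A) : φ.GNS →L[ℂ] φ.GNS :=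
  φ.gnsStarAlgHom a

/-- Right multiplication `b ↦ b a` on `A` with the inner product `⟪b, c⟫ = φ (b* c)`; it is
bounded since `φ` is a trace. -/
noncomputable def rightMulPre (φ : A →ₚ[ℂ] ℂ) (hφ : ∀ a b : A, φ (a * b) = φ (b * a)) (a : A) :
    φ.PreGNS →L[ℂ] φ.PreGNS :=
  LinearMap.mkContinuous
    (φ.toPreGNS.toLinearMap ∘ₗ LinearMap.mulRight ℂ a ∘ₗ φ.ofPreGNS.toLinearMap) ‖a‖ fun x ↦ by
      have key : φ (star (φ.ofPreGNS x * a) * (φ.ofPreGNS x * a)) ≤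
          (‖a‖ ^ 2 : ℝ) • φ (star (φ.ofPreGNS x) * φ.ofPreGNS x) := by
        set b := φ.ofPreGNS x
        have h : b * (a * star a) * star b ≤ ‖a * star a‖ • (b * star b) :=
          CStarAlgebra.star_right_conjugate_le_norm_smul
        rw [CStarRing.norm_self_mul_star, ← sq] at h
        calc φ (star (b * a) * (b * a)) = φ (b * (a * star a) * star b) := by
              rw [hφ, star_mul]; simp only [mul_assoc]
          _ ≤ φ (‖a‖ ^ 2 • (b * star b)) := OrderHomClass.mono φ h
          _ = (‖a‖ ^ 2 : ℝ) • φ (star b * b) := by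
              rw [hφ (star b) b, ← Complex.coe_smul, map_smul, Complex.coe_smul]
      rw [← sq_le_sq₀ (by positivity) (by positivity), mul_pow,
        ← RCLike.ofReal_le_ofReal (K := ℂ), RCLike.ofReal_pow, RCLike.ofReal_eq_complex_ofReal,
        PositiveLinearMap.preGNS_norm_sq]
      simpa [PositiveLinearMap.preGNS_norm_sq, Complex.real_smul] using key

/-- `R(a)` on `L²(A, φ)`: the extension of `b ↦ b a` to the completion. -/
noncomputable def rightMul (φ : A →ₚ[ℂ] ℂ) (hφ : ∀ a b : A, φ (a * b) = φ (b * a)) (a : A) :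
    φ.GNS →L[ℂ] φ.GNS :=
  (rightMulPre φ hφ a).completion

/-- The vector `e` of `L²(A, φ)` given by the unit of `A`. -/
noncomputable def unitVector (φ : A →ₚ[ℂ] ℂ) : φ.GNS :=
  ((φ.toPreGNS 1 : φ.PreGNS) : φ.GNS)

/-- The functional `T ↦ ⟨T e, e⟩` on `B(L²(A, φ))` (inner product linear in the argument `T e`). -/
noncomputable def vectorState (φ : A →ₚ[ℂ] ℂ) : (φ.GNS →L[ℂ] φ.GNS) →ₗ[ℂ] ℂ where
  toFun T := ⟪unitVector φ, T (unitVector φ)⟫_ℂ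
  map_add' S T := by simp [inner_add_right]
  map_smul' c T := by simp [inner_smul_right]

end StandardForm

end BiFree

/-! Left multiplications put their letters in front and right multiplications put theirs at the end.
So a word in `L(x), R(y)` and their adjoints, applied to the unit vector, gives the element of the
algebra in which the left letters come first in order and the right letters follow in reverse
(`vectorState_prod_letter`). This rearrangement is the order `≺_χ`, so the bi-free cumulants of
`(L(x), R(y))` are free cumulants of two-sided words in `x, x*, y, y*`. R-diagonality thus becomes a
vanishing condition inside the algebra itself (`IsRDiagonal.hasRDiagonalCumulants`).

It remains to recover the free cumulants of two-sided words from the mixed ones, by induction on the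
length (`freeCumulant_twoSided_eq`). Unless the word is alternating of even length, the cumulant is
zero. If it is, pairing its letters turns its moment into a moment of a `mixedTuple`. Subtuples of
such a tuple have the same form, so the mixed cumulants give this moment (`mixedMoment_eq`). The
moment-cumulant formula then gives the cumulant, since the other terms involve only shorter
two-sided words.

Every argument compares pairs in two possibly different algebras, which is what the existence of a
universal map `F` requires. -/

namespace BiFree

/-! ### Invariance of cumulants under relabelling, and their dependence on moments -/

section Transport

variable {ι κ : Type*} [DecidableEq ι] [DecidableEq κ]

/-- The image of a partition of `S` under an embedding. -/
def mapPartition (f : ι ↪ κ) {S : Finset ι} (π : Finpartition S) : Finpartition (S.map f) :=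
  Finpartition.ofExistsUnique (π.parts.map (Finset.mapEmbedding f).toEmbedding)
    (by
      intro V hV
      obtain ⟨W, hW, rfl⟩ := Finset.mem_map.mp hV
      exact Finset.map_subset_map.mpr (π.le hW))
    (by
      intro a ha
      obtain ⟨b, hb, rfl⟩ := Finset.mem_map.mp ha
      obtain ⟨V, ⟨hV, hbV⟩, hu⟩ := π.existsUnique_mem hb
      refine ⟨V.map f, ⟨Finset.mem_map_of_mem _ hV, Finset.mem_map_of_mem _ hbV⟩, ?_⟩
      rintro W ⟨hW, hbW⟩
      obtain ⟨U, hU, rfl⟩ := Finset.mem_map.mp hW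
      have hbU : b ∈ U := (Finset.mem_map' f).mp hbW
      rw [hu U ⟨hU, hbU⟩]
      rfl)
    (by
      intro h
      obtain ⟨V, hV, hV'⟩ := Finset.mem_map.mp h
      exact (π.nonempty_of_mem_parts hV).ne_empty (Finset.map_eq_empty.mp hV'))

theorem mapPartition_parts (f : ι ↪ κ) {S : Finset ι} (π : Finpartition S) :
    (mapPartition f π).parts = π.parts.map (Finset.mapEmbedding f).toEmbedding := rfl

theorem mapPartition_injective (f : ι ↪ κ) (S : Finset ι) :
    Function.Injective (mapPartition f (S := S)) := by
  intro π ρ h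
  have h' := congrArg Finpartition.parts h
  rw [mapPartition_parts, mapPartition_parts] at h'
  exact Finpartition.ext (Finset.map_injective _ h')

theorem mapPartition_surjective (f : ι ↪ κ) (S : Finset ι) :
    Function.Surjective (mapPartition f (S := S)) := by
  intro π
  have hmap : ∀ W ∈ π.parts, (S.filter fun a => f a ∈ W).map f = W := by
    intro W hW
    ext b
    simp only [Finset.mem_map, Finset.mem_filter]
    constructor
    · rintro ⟨a, ⟨_, ha⟩, rfl⟩
      exact ha
    · intro hb
      obtain ⟨a, ha, rfl⟩ := Finset.mem_map.mp (π.le hW hb)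
      exact ⟨a, ⟨ha, hb⟩, rfl⟩
  refine ⟨Finpartition.ofExistsUnique (π.parts.image fun W => S.filter fun a => f a ∈ W)
    ?_ ?_ ?_, ?_⟩
  · intro V hV
    obtain ⟨W, hW, rfl⟩ := Finset.mem_image.mp hV
    exact Finset.filter_subset _ _
  · intro a ha
    obtain ⟨W, ⟨hW, haW⟩, hu⟩ := π.existsUnique_mem (Finset.mem_map_of_mem f ha)
    refine ⟨_, ⟨Finset.mem_image_of_mem _ hW, Finset.mem_filter.mpr ⟨ha, haW⟩⟩, ?_⟩
    rintro V ⟨hV, haV⟩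
    obtain ⟨U, hU, rfl⟩ := Finset.mem_image.mp hV
    rw [hu U ⟨hU, (Finset.mem_filter.mp haV).2⟩]
  · intro h
    obtain ⟨W, hW, hW'⟩ := Finset.mem_image.mp h
    have h2 := hmap W hW
    rw [hW', Finset.map_empty] at h2
    exact (π.nonempty_of_mem_parts hW).ne_empty h2.symm
  · apply Finpartition.ext
    rw [mapPartition_parts]
    ext W
    simp only [Finpartition.ofExistsUnique, Finset.mem_map, Finset.mem_image]
    constructor
    · rintro ⟨_, ⟨W', hW', rfl⟩, rfl⟩
      have h2 := hmap W' hW'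
      simpa [h2] using hW'
    · intro hW
      exact ⟨_, ⟨W, hW, rfl⟩, hmap W hW⟩

theorem isNonCrossing_mapPartition_iff (f : ι ↪ κ) {prec : ι → ι → Prop} {prec' : κ → κ → Prop}
    (hf : ∀ a b, prec a b ↔ prec' (f a) (f b)) {S : Finset ι} (π : Finpartition S) :
    IsNonCrossing prec' (mapPartition f π) ↔ IsNonCrossing prec π := by
  simp [IsNonCrossing, mapPartition_parts, hf]

/-- The `Fintype` instance is left arbitrary so that the recursion can be rewritten whatever
decidability instances are in scope. -/
theorem cumulant_eq_sub_sum (prec : ι → ι → Prop)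
    (m : Finset ι → ℂ) (S : Finset ι)
    [Fintype {π : Finpartition S // IsNonCrossing prec π ∧ S ∉ π.parts}] :
    cumulant prec m S =
      m S - ∑ π : {π : Finpartition S // IsNonCrossing prec π ∧ S ∉ π.parts},
        ∏ V ∈ π.1.parts, cumulant prec m V := by
  rw [cumulant]
  congr 1
  refine Finset.sum_congr (by congr!) fun π _ => ?_
  exact Finset.prod_coe_sort π.1.parts (fun V => cumulant prec m V)

theorem ssubset_of_mem_parts {S V : Finset ι} {π : Finpartition S} (hS : S ∉ π.parts)
    (hV : V ∈ π.parts) : V ⊂ S :=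
  (show V ⊆ S from π.le hV).ssubset_of_ne fun h => hS (h ▸ hV)

open Classical in
/-- Cumulants are invariant under order embeddings that respect the moments. -/
theorem cumulant_map (f : ι ↪ κ) {prec : ι → ι → Prop} {prec' : κ → κ → Prop}
    (hf : ∀ a b, prec a b ↔ prec' (f a) (f b)) {m : Finset ι → ℂ} {m' : Finset κ → ℂ}
    (hm : ∀ S, m S = m' (S.map f)) (S : Finset ι) :
    cumulant prec m S = cumulant prec' m' (S.map f) := by
  induction S using Finset.strongInduction with
  | H S ih =>
    rw [cumulant_eq_sub_sum, cumulant_eq_sub_sum, hm]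
    congr 1
    have hmem : ∀ π : Finpartition S, S.map f ∈ (mapPartition f π).parts ↔ S ∈ π.parts := by
      intro π
      simp [mapPartition_parts]
    refine Finset.sum_bij
      (fun π _ => ⟨mapPartition f π.1, (isNonCrossing_mapPartition_iff f hf π.1).mpr π.2.1,
        fun h => π.2.2 ((hmem _).mp h)⟩) (fun _ _ => Finset.mem_univ _) ?_ ?_ ?_
    · intro π _ ρ _ h
      exact Subtype.ext (mapPartition_injective f S (congrArg Subtype.val h))
    · rintro ⟨ρ, hρ⟩ _
      obtain ⟨π, rfl⟩ := mapPartition_surjective f S ρ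
      exact ⟨⟨π, (isNonCrossing_mapPartition_iff f hf π).mp hρ.1,
        fun h => hρ.2 ((hmem _).mpr h)⟩, Finset.mem_univ _, rfl⟩
    · rintro ⟨π, hπ⟩ _
      simp only [mapPartition_parts, Finset.prod_map]
      exact Finset.prod_congr rfl fun V hV => ih V (ssubset_of_mem_parts hπ.2 hV)

-- In the recursion for the cumulant of `S`, only the moment of `S` itself and the cumulants of
-- proper non-empty blocks occur.
open Classical in
theorem cumulant_congr {prec : ι → ι → Prop} {m m' : Finset ι → ℂ} {S : Finset ι}
    (hm : m S = m' S)
    (h : ∀ V, V.Nonempty → V ⊂ S → cumulant prec m V = cumulant prec m' V) :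
    cumulant prec m S = cumulant prec m' S := by
  rw [cumulant_eq_sub_sum, cumulant_eq_sub_sum, hm]
  congr 1
  exact Finset.sum_congr rfl fun π _ => Finset.prod_congr rfl fun V hV =>
    h V (π.1.nonempty_of_mem_parts hV) (ssubset_of_mem_parts π.2.2 hV)

theorem moment_congr {prec : ι → ι → Prop} {m m' : Finset ι → ℂ} {S : Finset ι}
    (hS : S.Nonempty)
    (h : ∀ V, V.Nonempty → V ⊆ S → cumulant prec m V = cumulant prec m' V) : m S = m' S := by
  rw [moment_eq_sum_cumulant prec m S hS, moment_eq_sum_cumulant prec m' S hS]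
  exact Finset.sum_congr rfl fun π _ => Finset.prod_congr rfl fun V hV =>
    h V (π.1.nonempty_of_mem_parts hV) (π.1.le hV)

end Transport

/-! ### Free cumulants and moments of tuples determine each other -/

section FreeCumulants

variable {B B₁ B₂ : Type*} [Ring B] [Algebra ℂ B] [Ring B₁] [Algebra ℂ B₁] [Ring B₂] [Algebra ℂ B₂]

theorem tupleMoment_comp (φ : B →ₗ[ℂ] ℂ) {n m : ℕ} (T : Fin n → B) (f : Fin m ↪o Fin n)
    (S : Finset (Fin m)) : tupleMoment φ (T ∘ f) S = tupleMoment φ T (S.map f.toEmbedding) := by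
  have h : S.sort.map f = (S.map f.toEmbedding).sort :=
    StrictMonoOn.map_finsetSort f.toEmbedding S (f.strictMono.strictMonoOn _)
  rw [tupleMoment, tupleMoment, ← h, List.map_map]

theorem tupleMoment_univ (φ : B →ₗ[ℂ] ℂ) {n : ℕ} (T : Fin n → B) :
    tupleMoment φ T Finset.univ = φ (List.ofFn T).prod := by
  rw [tupleMoment, Fin.sort_univ, List.ofFn_eq_map]

/-- The increasing enumeration of `V` preserves order and moments, so blocks can be treated as
tuples in their own right. -/
theorem cumulant_tupleMoment (φ : B →ₗ[ℂ] ℂ) {n : ℕ} (T : Fin n → B) (V : Finset (Fin n)) :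
    cumulant (· < ·) (tupleMoment φ T) V = freeCumulant φ (T ∘ V.orderEmbOfFin rfl) := by
  rw [freeCumulant, cumulant_map (V.orderEmbOfFin rfl).toEmbedding (prec' := (· < ·))
    (fun a b => (OrderEmbedding.lt_iff_lt _).symm) (tupleMoment_comp φ T _)]
  rw [Finset.map_orderEmbOfFin_univ]

/-- The moment of a tuple is determined by the free cumulants of its non-empty subtuples. -/
theorem moment_eq_of_freeCumulant_eq (φ₁ : B₁ →ₗ[ℂ] ℂ) (φ₂ : B₂ →ₗ[ℂ] ℂ) {n : ℕ} (hn : 0 < n)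
    (T₁ : Fin n → B₁) (T₂ : Fin n → B₂)
    (h : ∀ (m : ℕ) (f : Fin m ↪o Fin n), 0 < m →
      freeCumulant φ₁ (T₁ ∘ f) = freeCumulant φ₂ (T₂ ∘ f)) :
    φ₁ (List.ofFn T₁).prod = φ₂ (List.ofFn T₂).prod := by
  rw [← tupleMoment_univ, ← tupleMoment_univ]
  refine moment_congr (prec := (· < ·)) ⟨⟨0, hn⟩, Finset.mem_univ _⟩ fun V hV _ => ?_
  rw [cumulant_tupleMoment, cumulant_tupleMoment]
  exact h _ _ hV.card_pos

/-- A free cumulant is determined by the moment and the free cumulants of proper subtuples. -/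
theorem freeCumulant_eq_of_moment_eq (φ₁ : B₁ →ₗ[ℂ] ℂ) (φ₂ : B₂ →ₗ[ℂ] ℂ) {n : ℕ}
    (T₁ : Fin n → B₁) (T₂ : Fin n → B₂)
    (hm : φ₁ (List.ofFn T₁).prod = φ₂ (List.ofFn T₂).prod)
    (h : ∀ (m : ℕ) (f : Fin m ↪o Fin n), 0 < m → m < n →
      freeCumulant φ₁ (T₁ ∘ f) = freeCumulant φ₂ (T₂ ∘ f)) :
    freeCumulant φ₁ T₁ = freeCumulant φ₂ T₂ := by
  refine cumulant_congr (by rw [tupleMoment_univ, tupleMoment_univ, hm]) fun V hV hV' => ?_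
  rw [cumulant_tupleMoment, cumulant_tupleMoment]
  exact h _ _ hV.card_pos (by simpa using Finset.card_lt_card hV')

end FreeCumulants

end BiFree
namespace BiFree

/-! ### The order `≺_χ` and two-sided words -/

section ChiOrder

theorem chiLT_asymm {n : ℕ} (χ : Fin n → Face) {i j : Fin n} (hij : chiLT χ i j) :
    ¬ chiLT χ j i := by
  unfold chiLT at *
  cases hi : χ i <;> cases hj : χ j <;> simp [hi, hj] at * <;> order

/-- By asymmetry of `≺_χ`, a list has at most one increasing arrangement. -/
theorem eq_of_perm_of_pairwise_chiLT {n : ℕ} (χ : Fin n → Face) {l l' : List (Fin n)}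
    (hl : l.Pairwise (chiLT χ)) (hl' : l'.Pairwise (chiLT χ)) (h : l.Perm l') : l = l' :=
  h.eq_of_pairwise (fun _ _ _ _ hab hba => (chiLT_asymm χ hab hba).elim) hl hl'

/-- First the left letters in their order, then the right letters in reverse order. -/
def chiRearrange {α : Type*} (χ : α → Face) (l : List α) : List α :=
  l.filter (fun i => χ i = .left) ++ (l.filter (fun i => χ i = .right)).reverse

theorem chiRearrange_perm {α : Type*} (χ : α → Face) (l : List α) :
    (chiRearrange χ l).Perm l := by
  refine (List.Perm.append_left _ (List.reverse_perm _)).trans ?_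
  have : (fun i => decide (χ i = .right)) = (fun i => !decide (χ i = .left)) := by
    funext i
    cases h : χ i <;> simp
  rw [this]
  exact List.filter_append_perm _ _

theorem chiRearrange_map {α β : Type*} (χ : β → Face) (g : α → β) (l : List α) :
    chiRearrange χ (l.map g) = (chiRearrange (χ ∘ g) l).map g := by
  simp [chiRearrange, List.filter_map, Function.comp_def]

theorem chiRearrange_pairwise {n : ℕ} (χ : Fin n → Face) {l : List (Fin n)}
    (hl : l.Pairwise (· < ·)) : (chiRearrange χ l).Pairwise (chiLT χ) := by
  unfold chiRearrange
  rw [List.pairwise_append]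
  refine ⟨?_, ?_, ?_⟩
  · refine List.Pairwise.imp_of_mem ?_ (hl.filter _)
    intro a b ha hb h
    simp at ha hb
    simp [chiLT, ha, hb, h]
  · rw [List.pairwise_reverse]
    refine List.Pairwise.imp_of_mem ?_ (hl.filter _)
    intro a b ha hb h
    simp at ha hb
    simp [chiLT, ha, hb, h]
  · intro a ha b hb
    simp at ha hb
    simp [chiLT, ha, hb]

/-- A word is two-sided if its left letters precede its right letters. -/
def IsTwoSided {n : ℕ} (w : Fin n → Face × Bool) : Prop :=
  ∀ i j, i ≤ j → (w j).1 = .left → (w i).1 = .left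

theorem IsTwoSided.comp {n m : ℕ} {w : Fin n → Face × Bool} (hw : IsTwoSided w)
    (f : Fin m ↪o Fin n) : IsTwoSided (w ∘ f) :=
  fun i j hij => hw (f i) (f j) (f.monotone hij)

theorem exists_lt_iff_of_downwardClosed (N : ℕ) (P : ℕ → Prop) (hP : ∀ i j, i ≤ j → P j → P i)
    (hN : ¬ P N) : ∃ k ≤ N, ∀ i, P i ↔ i < k := by
  classical
  have hex : ∃ k, ¬ P k := ⟨N, hN⟩
  refine ⟨Nat.find hex, Nat.find_le hN, fun i => ⟨fun h => ?_, fun h => ?_⟩⟩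
  · by_contra hi
    exact Nat.find_spec hex (hP _ _ (not_lt.mp hi) h)
  · by_contra hi
    exact Nat.find_min hex h hi

theorem IsTwoSided.exists_left_iff {n : ℕ} {w : Fin n → Face × Bool} (hw : IsTwoSided w) :
    ∃ k ≤ n, ∀ i : Fin n, (w i).1 = .left ↔ (i : ℕ) < k := by
  obtain ⟨k, hk, h⟩ := exists_lt_iff_of_downwardClosed n
    (fun i => ∃ hi : i < n, (w ⟨i, hi⟩).1 = .left)
    (fun i j hij ⟨hj, hw'⟩ => ⟨hij.trans_lt hj, hw ⟨i, _⟩ ⟨j, hj⟩ hij hw'⟩) (by simp)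
  exact ⟨k, hk, fun i => by rw [← h]; simp⟩

/-- The involution of `{0, …, n - 1}` that reverses `{k, …, n - 1}`. -/
def reverseFrom (n k : ℕ) (i : Fin n) : Fin n :=
  if (i : ℕ) < k then i else ⟨n - 1 - (i - k), by omega⟩

theorem reverseFrom_val (n k : ℕ) (i : Fin n) :
    (reverseFrom n k i : ℕ) = if (i : ℕ) < k then (i : ℕ) else n - 1 - (i - k) := by
  unfold reverseFrom
  split_ifs <;> rfl

theorem reverseFrom_lt_iff (n k : ℕ) (i : Fin n) : (reverseFrom n k i : ℕ) < k ↔ (i : ℕ) < k := by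
  rw [reverseFrom_val]
  split_ifs <;> omega

theorem reverseFrom_reverseFrom (n k : ℕ) (i : Fin n) :
    reverseFrom n k (reverseFrom n k i) = i := by
  apply Fin.ext
  have h := reverseFrom_lt_iff n k i
  have h2 := reverseFrom_val n k i
  rw [reverseFrom_val]
  split_ifs at * <;> omega

/-- When the left indices are exactly `0, …, k - 1`, the order `≺_χ` lists `0, …, k - 1, n - 1, …,
k`, which is the sequence of values of `reverseFrom n k`. -/
theorem chiLT_reverseFrom {n k : ℕ} {χ : Fin n → Face} (hχ : ∀ i, χ i = .left ↔ (i : ℕ) < k)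
    (i j : Fin n) : i < j ↔ chiLT χ (reverseFrom n k i) (reverseFrom n k j) := by
  have hχ' : ∀ i, χ (reverseFrom n k i) = .left ↔ (i : ℕ) < k := fun i => by
    rw [hχ, reverseFrom_lt_iff]
  have hi := hχ' i
  have hj := hχ' j
  have vi := reverseFrom_val n k i
  have vj := reverseFrom_val n k j
  unfold chiLT
  cases h1 : χ (reverseFrom n k i) <;> cases h2 : χ (reverseFrom n k j) <;>
    simp [h1, h2] at hi hj ⊢ <;> try rw [Fin.lt_def, Fin.lt_def]
  all_goals split_ifs at vi vj <;> omega

end ChiOrder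

/-! ### Two-sided words are controlled by the mixed cumulants -/

section Mixed

variable {B B₁ B₂ : Type*} [Ring B] [Algebra ℂ B] [StarRing B]
  [Ring B₁] [Algebra ℂ B₁] [StarRing B₁] [Ring B₂] [Algebra ℂ B₂] [StarRing B₂]

/-- A subtuple of a tuple of alternating products is again such a tuple. -/
theorem exists_mixedTuple_comp {n m : ℕ} (k : ℕ) (f : Fin m ↪o Fin n) :
    ∃ k' ≤ 2 * m, ∀ i : Fin m, (2 * (i : ℕ) < k' ↔ 2 * (f i : ℕ) < k) ∧
      (2 * (i : ℕ) + 1 < k' ↔ 2 * (f i : ℕ) + 1 < k) := by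
  obtain ⟨k', hk', h⟩ := exists_lt_iff_of_downwardClosed (2 * m)
    -- The number `t = 2 i + r` stands for letter `r` of the `i`-th selected pair, whose position in
    -- the long word is `2 f(i) + r`. This position increases with `t`, so the left letters of the
    -- subtuple still form an initial segment.
    (fun t => ∃ ht : t / 2 < m, 2 * (f ⟨t / 2, ht⟩ : ℕ) + t % 2 < k)
    (by
      rintro s t hst ⟨ht, hlt⟩
      have hs : s / 2 < m := by omega
      refine ⟨hs, ?_⟩
      rcases Nat.lt_or_ge (s / 2) (t / 2) with h | h
      · have : (f ⟨s / 2, hs⟩ : ℕ) < f ⟨t / 2, ht⟩ := f.strictMono (show _ < _ from h)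
        omega
      · have h' : s / 2 = t / 2 := by omega
        have : (f ⟨s / 2, hs⟩ : ℕ) = f ⟨t / 2, ht⟩ := by simp only [h']
        omega)
    (by
      rintro ⟨h, -⟩
      omega)
  refine ⟨k', hk', fun i => ?_⟩
  rw [← h, ← h]
  have h1 : 2 * (i : ℕ) / 2 = i := by omega
  have h2 : (2 * (i : ℕ) + 1) / 2 = i := by omega
  have h3 : 2 * (i : ℕ) % 2 = 0 := by omega
  have h4 : (2 * (i : ℕ) + 1) % 2 = 1 := by omega
  simp [h1, h2, h4]

theorem mixedMoment_eq {φ₁ : B₁ →ₗ[ℂ] ℂ} {φ₂ : B₂ →ₗ[ℂ] ℂ} {x₁ y₁ : B₁} {x₂ y₂ : B₂}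
    (hκ : ∀ n k : ℕ, 1 ≤ n → k ≤ 2 * n → ∀ ε,
      mixedCumulant φ₁ x₁ y₁ n k ε = mixedCumulant φ₂ x₂ y₂ n k ε)
    {n : ℕ} (hn : 0 < n) (k : ℕ) (ε : Bool) :
    φ₁ (List.ofFn (mixedTuple x₁ y₁ n k ε)).prod =
      φ₂ (List.ofFn (mixedTuple x₂ y₂ n k ε)).prod := by
  refine moment_eq_of_freeCumulant_eq φ₁ φ₂ hn _ _ fun m f hm => ?_
  obtain ⟨k', hk', h⟩ := exists_mixedTuple_comp k f
  have key := hκ m k' hm hk' ε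
  have e1 : mixedTuple x₁ y₁ n k ε ∘ f = mixedTuple x₁ y₁ m k' ε := by
    funext i
    simp [mixedTuple, h]
  have e2 : mixedTuple x₂ y₂ n k ε ∘ f = mixedTuple x₂ y₂ m k' ε := by
    funext i
    simp [mixedTuple, h]
  rw [e1, e2]
  exact key

/-- The product of an alternating word of even length, with its letters multiplied in pairs. -/
theorem prod_letters_eq_prod_mixedTuple {B : Type*} [Ring B] [StarRing B] (x y : B) {n k : ℕ} {ε : Bool}
    {w : Fin (n * 2) → Face × Bool}
    (hk : ∀ i, (w i).1 = .left ↔ (i : ℕ) < k)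
    (hε : ∀ i, (w i).2 = if (i : ℕ) % 2 = 0 then ε else !ε) :
    (List.ofFn fun i => letter x y (w i).1 (w i).2).prod =
      (List.ofFn (mixedTuple x y n k ε)).prod := by
  have hface : ∀ i, (w i).1 = if (i : ℕ) < k then .left else .right := by
    intro i
    have := hk i
    cases h : (w i).1 <;> simp_all
  rw [List.ofFn_mul, List.prod_flatten, List.map_ofFn]
  congr 2
  funext i
  simp only [Function.comp_apply, List.ofFn_succ, List.ofFn_zero, List.prod_cons, List.prod_nil,
    mul_one, mixedTuple, hface, hε]
  simp [mul_comm, Nat.add_mod]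

theorem alternating_eq {n : ℕ} {b : Fin n → Bool} (hb : (List.ofFn b).IsChain (· ≠ ·)) :
    ∃ ε, ∀ i : Fin n, b i = if (i : ℕ) % 2 = 0 then ε else !ε := by
  rcases Nat.eq_zero_or_pos n with rfl | hn
  -- The empty word has no first letter, so the value of `ε` is arbitrary here.
  · exact ⟨true, fun i => i.elim0⟩
  rw [List.isChain_ofFn] at hb
  refine ⟨b ⟨0, hn⟩, ?_⟩
  rintro ⟨i, hi⟩
  induction i with
  | zero => simp
  | succ i ih =>
    have h1 := hb i hi
    rw [ih (by omega)] at h1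
    rcases Nat.mod_two_eq_zero_or_one i with h | h
    · have h' : (i + 1) % 2 = 1 := by omega
      simp only [h, h', if_true] at h1 ⊢
      cases h0 : b ⟨0, hn⟩ <;> cases h2 : b ⟨i + 1, hi⟩ <;> simp_all
    · have h' : (i + 1) % 2 = 0 := by omega
      simp only [h, h'] at h1 ⊢
      cases h0 : b ⟨0, hn⟩ <;> cases h2 : b ⟨i + 1, hi⟩ <;> simp_all

/-- The one-algebra form of R-diagonality: the free cumulants of two-sided words vanish unless the
words have even length and alternate. -/
def HasRDiagonalCumulants (φ : B →ₗ[ℂ] ℂ) (x y : B) : Prop :=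
  ∀ (n : ℕ) (w : Fin n → Face × Bool), IsTwoSided w →
    ¬ (Even n ∧ (List.ofFn fun i => (w i).2).IsChain (· ≠ ·)) →
      freeCumulant φ (fun i => letter x y (w i).1 (w i).2) = 0

theorem freeCumulant_twoSided_eq {φ₁ : B₁ →ₗ[ℂ] ℂ} {φ₂ : B₂ →ₗ[ℂ] ℂ} {x₁ y₁ : B₁} {x₂ y₂ : B₂}
    (h₁ : HasRDiagonalCumulants φ₁ x₁ y₁) (h₂ : HasRDiagonalCumulants φ₂ x₂ y₂)
    (hκ : ∀ n k : ℕ, 1 ≤ n → k ≤ 2 * n → ∀ ε,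
      mixedCumulant φ₁ x₁ y₁ n k ε = mixedCumulant φ₂ x₂ y₂ n k ε)
    (n : ℕ) (hn : 0 < n) (w : Fin n → Face × Bool) (hw : IsTwoSided w) :
    freeCumulant φ₁ (fun i => letter x₁ y₁ (w i).1 (w i).2) =
      freeCumulant φ₂ (fun i => letter x₂ y₂ (w i).1 (w i).2) := by
  induction n using Nat.strong_induction_on with
  | _ n ih =>
    by_cases halt : Even n ∧ (List.ofFn fun i => (w i).2).IsChain (· ≠ ·)
    -- Proper subwords of a two-sided word are two-sided, so the induction hypothesis covers them
    -- even when they no longer alternate. Only the full moment remains.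
    · refine freeCumulant_eq_of_moment_eq φ₁ φ₂ _ _ ?_
        fun m f hm hmn => ih m hmn hm (w ∘ f) (hw.comp f)
      obtain ⟨hev, hch⟩ := halt
      obtain ⟨m, rfl⟩ : ∃ m, n = m * 2 := hev.exists_two_nsmul.imp fun m h => by
        rw [h, smul_eq_mul, mul_comm]
      obtain ⟨k, -, hk⟩ := hw.exists_left_iff
      obtain ⟨ε, hε⟩ := alternating_eq hch
      rw [prod_letters_eq_prod_mixedTuple x₁ y₁ hk hε, prod_letters_eq_prod_mixedTuple x₂ y₂ hk hε]
      exact mixedMoment_eq hκ (by omega) k ε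
    · rw [h₁ n w hw halt, h₂ n w hw halt]

theorem moment_twoSided_eq {φ₁ : B₁ →ₗ[ℂ] ℂ} {φ₂ : B₂ →ₗ[ℂ] ℂ} {x₁ y₁ : B₁} {x₂ y₂ : B₂}
    (h₁ : HasRDiagonalCumulants φ₁ x₁ y₁) (h₂ : HasRDiagonalCumulants φ₂ x₂ y₂)
    (hκ : ∀ n k : ℕ, 1 ≤ n → k ≤ 2 * n → ∀ ε,
      mixedCumulant φ₁ x₁ y₁ n k ε = mixedCumulant φ₂ x₂ y₂ n k ε)
    {n : ℕ} (hn : 0 < n) {w : Fin n → Face × Bool} (hw : IsTwoSided w) :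
    φ₁ (List.ofFn fun i => letter x₁ y₁ (w i).1 (w i).2).prod =
      φ₂ (List.ofFn fun i => letter x₂ y₂ (w i).1 (w i).2).prod :=
  moment_eq_of_freeCumulant_eq φ₁ φ₂ hn _ _ fun m f hm =>
    freeCumulant_twoSided_eq h₁ h₂ hκ m hm (w ∘ f) (hw.comp f)

end Mixed

/-! ### Passage from operators on `L²` to the algebra -/

section StandardForm

variable {A : Type*} [CStarAlgebra A] [PartialOrder A] [StarOrderedRing A]

theorem leftMul_coe (φ : A →ₚ[ℂ] ℂ) (a b : A) :
    leftMul φ a ((φ.toPreGNS b : φ.PreGNS) : φ.GNS) = ((φ.toPreGNS (a * b) : φ.PreGNS) : φ.GNS) := by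
  exact φ.gnsNonUnitalStarAlgHom_apply_coe

theorem rightMul_coe (φ : A →ₚ[ℂ] ℂ) (hφ : ∀ a b : A, φ (a * b) = φ (b * a)) (a b : A) :
    rightMul φ hφ a ((φ.toPreGNS b : φ.PreGNS) : φ.GNS) =
      ((φ.toPreGNS (b * a) : φ.PreGNS) : φ.GNS) := by
  rw [rightMul, ContinuousLinearMap.completion_apply_coe]
  rfl

theorem star_leftMul (φ : A →ₚ[ℂ] ℂ) (a : A) : star (leftMul φ a) = leftMul φ (star a) :=
  (map_star φ.gnsStarAlgHom a).symm

/-- On the dense subspace, traciality gives `⟪b a*, c⟫ = φ(a b* c) = φ(b* c a) = ⟪b, c a⟫`. -/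
theorem star_rightMul (φ : A →ₚ[ℂ] ℂ) (hφ : ∀ a b : A, φ (a * b) = φ (b * a)) (a : A) :
    star (rightMul φ hφ a) = rightMul φ hφ (star a) := by
  refine ((ContinuousLinearMap.eq_adjoint_iff _ _).mpr fun b c => ?_).symm
  induction b, c using UniformSpace.Completion.induction_on₂ with
  | hp => apply isClosed_eq <;> fun_prop
  | ih b c =>
    have hb := rightMul_coe φ hφ (star a) (φ.ofPreGNS b)
    have hc := rightMul_coe φ hφ a (φ.ofPreGNS c)
    rw [φ.toPreGNS_ofPreGNS] at hb hc
    rw [hb, hc, UniformSpace.Completion.inner_coe, UniformSpace.Completion.inner_coe,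
      φ.preGNS_inner_def, φ.preGNS_inner_def, φ.ofPreGNS_toPreGNS, φ.ofPreGNS_toPreGNS,
      star_mul, star_star, mul_assoc, hφ, mul_assoc]

theorem letter_coe (φ : A →ₚ[ℂ] ℂ) (hφ : ∀ a b : A, φ (a * b) = φ (b * a)) (x y : A) (s : Bool)
    (c : Face) (b : A) :
    letter (leftMul φ x) (rightMul φ hφ y) c s ((φ.toPreGNS b : φ.PreGNS) : φ.GNS) =
      ((φ.toPreGNS (if c = .left then letter x y c s * b else b * letter x y c s) : φ.PreGNS) :
        φ.GNS) := by
  cases c <;> cases s <;>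
    simp [letter, star_leftMul, star_rightMul, leftMul_coe, rightMul_coe]

/-- A word in left and right multiplications, applied to the vector of the unit. -/
theorem prod_letter_unitVector (φ : A →ₚ[ℂ] ℂ) (hφ : ∀ a b : A, φ (a * b) = φ (b * a)) (x y : A)
    (l : List (Face × Bool)) :
    (l.map fun p => letter (leftMul φ x) (rightMul φ hφ y) p.1 p.2).prod (unitVector φ) =
      ((φ.toPreGNS ((chiRearrange Prod.fst l).map fun p => letter x y p.1 p.2).prod : φ.PreGNS) :
        φ.GNS) := by
  induction l with
  | nil => simp [chiRearrange, unitVector]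
  | cons p l ih =>
    rw [List.map_cons, List.prod_cons, mul_apply_eq_comp, ih, letter_coe]
    rcases p with ⟨c, s⟩
    -- The outermost operator acts last: a left letter becomes the first factor and a right letter
    -- the last, whence the reversal of the right letters.
    cases c <;> simp [chiRearrange, mul_assoc]

theorem vectorState_prod_letter (φ : A →ₚ[ℂ] ℂ) (hφ : ∀ a b : A, φ (a * b) = φ (b * a)) (x y : A)
    (l : List (Face × Bool)) :
    vectorState φ (l.map fun p => letter (leftMul φ x) (rightMul φ hφ y) p.1 p.2).prod =
      φ ((chiRearrange Prod.fst l).map fun p => letter x y p.1 p.2).prod := by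
  change ⟪unitVector φ, _⟫_ℂ = _
  rw [prod_letter_unitVector, unitVector, UniformSpace.Completion.inner_coe, φ.preGNS_inner_def,
    φ.ofPreGNS_toPreGNS, φ.ofPreGNS_toPreGNS, star_one, one_mul]

/-- Reversing the right part of a two-sided word gives an operator word whose `≺_χ`-rearrangement is
the original one. This reversal carries the natural order to `≺_χ` and respects moments of all
subwords, so the free and bi-free cumulants agree. -/
theorem IsRDiagonal.hasRDiagonalCumulants {φ : A →ₚ[ℂ] ℂ}
    {hφ : ∀ a b : A, φ (a * b) = φ (b * a)} {x y : A}
    (h : IsRDiagonal (vectorState φ) (leftMul φ x) (rightMul φ hφ y)) :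
    HasRDiagonalCumulants φ.toLinearMap x y := by
  intro n w hw halt
  obtain ⟨k, -, hk⟩ := hw.exists_left_iff
  let τ : Fin n ↪ Fin n :=
    ⟨reverseFrom n k, Function.LeftInverse.injective (reverseFrom_reverseFrom n k)⟩
  have hττ : ∀ i, τ (τ i) = i := reverseFrom_reverseFrom n k
  let χ : Fin n → Face := fun i => (w (τ i)).1
  let ω : Fin n → Bool := fun i => (w (τ i)).2
  have hχ : ∀ i, χ i = .left ↔ (i : ℕ) < k := fun i => by
    rw [← reverseFrom_lt_iff n k i]
    exact hk _
  have hτ : ∀ i j, i < j ↔ chiLT χ (τ i) (τ j) := chiLT_reverseFrom hχ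
  have hpair : ∀ l : List (Fin n), l.Pairwise (· < ·) → (l.map τ).Pairwise (chiLT χ) :=
    fun l hl => List.pairwise_map.mpr (hl.imp fun {a b} hab => (hτ a b).mp hab)
  have hlist : chiList χ = (List.finRange n).map τ := by
    refine eq_of_perm_of_pairwise_chiLT χ (chiList_pairwise χ)
      (hpair _ (List.pairwise_lt_finRange n)) ((chiList_perm χ).trans ?_)
    refine (List.perm_ext_iff_of_nodup (List.nodup_finRange n)
      ((List.nodup_finRange n).map τ.injective)).mpr fun i => ?_
    simp only [List.mem_finRange, List.mem_map, true_and, true_iff]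
    exact ⟨τ i, hττ i⟩
  have hκ := h n χ ω (by
    rw [hlist, List.map_map, ← List.ofFn_eq_map]
    simpa [ω, Function.comp_def, hττ] using halt)
  rw [← hκ, freeCumulant, biFreeCumulant, cumulant_map τ hτ (m' := tupleMoment (vectorState φ)
    fun i => letter (leftMul φ x) (rightMul φ hφ y) (χ i) (ω i)), Finset.map_univ_of_surjective]
  · exact fun i => ⟨τ i, hττ i⟩
  · intro S
    have hmap : ((S.map τ).sort.map fun i => letter (leftMul φ x) (rightMul φ hφ y) (χ i) (ω i)) =
        ((S.map τ).sort.map (w ∘ τ)).map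
          fun p => letter (leftMul φ x) (rightMul φ hφ y) p.1 p.2 := by
      rw [List.map_map]
      rfl
    -- Both lists are `≺_χ`-increasing with the same elements. This matches the moments of every
    -- subset, as `cumulant_map` needs.
    have hS : chiRearrange χ (S.map τ).sort = S.sort.map τ := by
      refine eq_of_perm_of_pairwise_chiLT χ
        (chiRearrange_pairwise χ (Finset.sortedLT_sort _).pairwise)
        (hpair _ (Finset.sortedLT_sort _).pairwise) ((chiRearrange_perm _ _).trans ?_)
      refine (List.perm_ext_iff_of_nodup (Finset.sort_nodup _ _)
        ((Finset.sort_nodup _ _).map τ.injective)).mpr fun i => ?_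
      simp
    rw [tupleMoment, tupleMoment, hmap, vectorState_prod_letter, chiRearrange_map]
    change _ = φ (List.map _ (List.map _ (chiRearrange χ _))).prod
    rw [hS, List.map_map, List.map_map]
    simp only [Function.comp_def, hττ]
    rfl

theorem isTwoSided_chiRearrange (l : List (Face × Bool)) :
    IsTwoSided (chiRearrange Prod.fst l).get := by
  have hp : (chiRearrange Prod.fst l).Pairwise
      fun p q : Face × Bool => q.1 = .left → p.1 = .left := by
    unfold chiRearrange
    rw [List.pairwise_append]
    refine ⟨?_, List.pairwise_reverse.mpr ?_, by simp +contextual⟩ <;>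
      -- Within one face the relation follows from membership alone, so a trivial pairwise relation
      -- is enough to start from.
      refine List.Pairwise.imp_of_mem ?_ (List.pairwise_of_forall (R := fun _ _ => True) fun _ _ => trivial) <;>
      simp +contextual
  intro i j hij
  rcases hij.eq_or_lt with rfl | hlt
  · exact id
  · exact List.pairwise_iff_get.mp hp i j hlt

theorem ofFn_comp_get {α β : Type*} (l : List α) (g : α → β) :
    List.ofFn (fun i => g (l.get i)) = l.map g := by
  conv_rhs => rw [← List.ofFn_get l, List.map_ofFn]
  rfl

/-- The `*`-distribution of an R-diagonal pair is determined by its mixed cumulants. -/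
theorem starMoment_eq_of_mixedCumulant_eq {A₁ A₂ : Type*} [CStarAlgebra A₁] [PartialOrder A₁]
    [StarOrderedRing A₁] [CStarAlgebra A₂] [PartialOrder A₂] [StarOrderedRing A₂]
    {φ₁ : A₁ →ₚ[ℂ] ℂ} {φ₂ : A₂ →ₚ[ℂ] ℂ} (hφ₁ : IsFaithfulNormalTracialState φ₁)
    (hφ₂ : IsFaithfulNormalTracialState φ₂) {x₁ y₁ : A₁} {x₂ y₂ : A₂}
    (h₁ : IsRDiagonal (vectorState φ₁) (leftMul φ₁ x₁) (rightMul φ₁ hφ₁.tracial y₁))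
    (h₂ : IsRDiagonal (vectorState φ₂) (leftMul φ₂ x₂) (rightMul φ₂ hφ₂.tracial y₂))
    (hκ : ∀ n k : ℕ, 1 ≤ n → k ≤ 2 * n → ∀ ε,
      mixedCumulant φ₁.toLinearMap x₁ y₁ n k ε = mixedCumulant φ₂.toLinearMap x₂ y₂ n k ε)
    (l : List (Face × Bool)) :
    starMoment (vectorState φ₁) (leftMul φ₁ x₁) (rightMul φ₁ hφ₁.tracial y₁) l =
      starMoment (vectorState φ₂) (leftMul φ₂ x₂) (rightMul φ₂ hφ₂.tracial y₂) l := by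
  rw [starMoment, starMoment, vectorState_prod_letter, vectorState_prod_letter]
  have hw := isTwoSided_chiRearrange l
  generalize chiRearrange Prod.fst l = w at hw
  rcases w with - | ⟨p, w⟩
  -- The moment-cumulant formula needs a non-empty index set; the empty word has moment `φ(1) = 1`.
  · simp [hφ₁.map_one, hφ₂.map_one]
  · have key := moment_twoSided_eq h₁.hasRDiagonalCumulants h₂.hasRDiagonalCumulants hκ
      (by simp) hw
    rw [ofFn_comp_get (p :: w) fun q => letter x₁ y₁ q.1 q.2,
      ofFn_comp_get (p :: w) fun q => letter x₂ y₂ q.1 q.2] at key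
    exact key

end StandardForm

end BiFree
-- The proposition
theorem proposition3p1 :
    -- the `*`-distribution is determined by the mixed free cumulants
    (∃ F : (ℕ → ℕ → Bool → ℂ) → (List (BiFree.Face × Bool) → ℂ),
      ∀ (A : Type u) [CStarAlgebra A] [WStarAlgebra A] [PartialOrder A] [StarOrderedRing A]
        (φ : A →ₚ[ℂ] ℂ) (hφ : BiFree.IsFaithfulNormalTracialState φ) (x y : A),
        BiFree.IsRDiagonal (BiFree.vectorState φ)
            (BiFree.leftMul φ x) (BiFree.rightMul φ hφ.tracial y) →
          BiFree.starMoment (BiFree.vectorState φ)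
              (BiFree.leftMul φ x) (BiFree.rightMul φ hφ.tracial y) =
            F (BiFree.mixedCumulant φ.toLinearMap x y)) ∧
    -- R-diagonal pairs with the same mixed free cumulants are identically `*`-distributed
    (∀ (A : Type u) [CStarAlgebra A] [WStarAlgebra A] [PartialOrder A] [StarOrderedRing A]
      (φ : A →ₚ[ℂ] ℂ) (hφ : BiFree.IsFaithfulNormalTracialState φ) (x₁ y₁ x₂ y₂ : A),
      BiFree.IsRDiagonal (BiFree.vectorState φ)
          (BiFree.leftMul φ x₁) (BiFree.rightMul φ hφ.tracial y₁) →
      BiFree.IsRDiagonal (BiFree.vectorState φ)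
          (BiFree.leftMul φ x₂) (BiFree.rightMul φ hφ.tracial y₂) →
      (∀ n k : ℕ, 1 ≤ n → k ≤ 2 * n →
        BiFree.mixedCumulant φ.toLinearMap x₁ y₁ n k false =
            BiFree.mixedCumulant φ.toLinearMap x₂ y₂ n k false ∧
          BiFree.mixedCumulant φ.toLinearMap x₁ y₁ n k true =
            BiFree.mixedCumulant φ.toLinearMap x₂ y₂ n k true) →
      BiFree.IdenticallyStarDistributed (BiFree.vectorState φ)
        (BiFree.leftMul φ x₁) (BiFree.rightMul φ hφ.tracial y₁)
        (BiFree.leftMul φ x₂) (BiFree.rightMul φ hφ.tracial y₂)) := by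
  classical
  constructor
  -- `P` is the relation "some R-diagonal pair has mixed cumulants `c` and `*`-moments `M`". The
  -- comparison across algebras makes it single-valued, so `F` can choose any such `M`; the value
  -- `0` at unattained `c` plays no role.
  · let P (c : ℕ → ℕ → Bool → ℂ) (M : List (BiFree.Face × Bool) → ℂ) : Prop :=
      ∃ (A : Type u) (_ : CStarAlgebra A) (_ : PartialOrder A) (_ : StarOrderedRing A)
        (φ : A →ₚ[ℂ] ℂ) (hφ : BiFree.IsFaithfulNormalTracialState φ) (x y : A),
        BiFree.IsRDiagonal (BiFree.vectorState φ)
            (BiFree.leftMul φ x) (BiFree.rightMul φ hφ.tracial y) ∧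
          BiFree.mixedCumulant φ.toLinearMap x y = c ∧
          BiFree.starMoment (BiFree.vectorState φ)
            (BiFree.leftMul φ x) (BiFree.rightMul φ hφ.tracial y) = M
    refine ⟨fun c => if h : ∃ M, P c M then h.choose else 0, ?_⟩
    intro A _ _ _ _ φ hφ x y h
    have hex : ∃ M, P (BiFree.mixedCumulant φ.toLinearMap x y) M :=
      ⟨_, A, _, _, _, φ, hφ, x, y, h, rfl, rfl⟩
    beta_reduce
    rw [dif_pos hex]
    obtain ⟨A', _, _, _, φ', hφ', x', y', h', hκ, hM⟩ := hex.choose_spec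
    rw [← hM]
    funext l
    exact BiFree.starMoment_eq_of_mixedCumulant_eq hφ hφ' h h' (fun n k _ _ ε => by rw [hκ]) l
  · intro A _ _ _ _ φ hφ x₁ y₁ x₂ y₂ h₁ h₂ hκ l
    refine BiFree.starMoment_eq_of_mixedCumulant_eq hφ hφ h₁ h₂ (fun n k hn hk ε => ?_) l
    cases ε
    · exact (hκ n k hn hk).1
    · exact (hκ n k hn hk).2
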